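/- For an integer $k\ge 1$ and a real $\lambda>0$, the Poisson distribution of order $k$ with parameter $\lambda$ is the distribution on the non-negative integers with probability mass function $$f_k(x;\lambda)=\sum e^{-k\lambda}\,\frac{\lambda^{x_1+x_2+\cdots+x_k}}{x_1!\,x_2!\cdots x_k!},\qquad x=0,1,2,\ldots,$$ where the sum is over all $k$-tuples $(x_1,\ldots,x_k)$ of non-negative integers with $x_1+2x_2+\cdots+kx_k=x$. A mode is a value of $x$ at which $f_k(x;\lambda)$ attains its maximum over all non-negative integers. **Theorem 2.2.** For every positive integer $\lambda$ and every integer $k$ with $2\le k\le 5$, the Poisson distribution of order $k$ with parameter $\lambda$ has a unique mode $m_{k,\lambda}$, and $$m_{k,\lambda}=\frac{\lambda k(k+1)}{2}-\left\lfloor \frac{k}{2}\right\rfloor .$$ -/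

import Mathlib

open scoped Nat

/-- The `k`-tuples `(x₁, …, x_k)` of non-negative integers with `x₁ + 2 x₂ + ⋯ + k x_k = n`.
The entry `x_{i+1}` is `x i` for `i : Fin k`. The bound `x i ≤ n`, which only serves to make the set
visibly finite, is automatic: see `mem_orderTuples`. -/
def orderTuples (k n : ℕ) : Finset (Fin k → ℕ) :=
  (Fintype.piFinset fun _ : Fin k => Finset.range (n + 1)).filter
    fun x => ∑ i : Fin k, ((i : ℕ) + 1) * x i = n

theorem mem_orderTuples {k n : ℕ} {x : Fin k → ℕ} :
    x ∈ orderTuples k n ↔ ∑ i : Fin k, ((i : ℕ) + 1) * x i = n := by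
  simp only [orderTuples, Finset.mem_filter, Fintype.mem_piFinset, Finset.mem_range,
    and_iff_right_iff_imp]
  intro h i
  have h1 : ((i : ℕ) + 1) * x i ≤ ∑ j : Fin k, ((j : ℕ) + 1) * x j :=
    Finset.single_le_sum (f := fun j : Fin k => ((j : ℕ) + 1) * x j)
      (fun _ _ => Nat.zero_le _) (Finset.mem_univ i)
  have h2 : x i ≤ ((i : ℕ) + 1) * x i := Nat.le_mul_of_pos_left _ (Nat.succ_pos _)
  omega

/-- The probability mass function `f_k(n; l)` of the Poisson distribution of order `k` with
parameter `l`: the sum, over all `k`-tuples of non-negative integers with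
`x₁ + 2 x₂ + ⋯ + k x_k = n`, of `e^{-k l} l^{x₁ + ⋯ + x_k} / (x₁! ⋯ x_k!)`. -/
noncomputable def poissonOrderPMF (k : ℕ) (l : ℝ) (n : ℕ) : ℝ :=
  ∑ x ∈ orderTuples k n,
    Real.exp (-(k * l)) * (l ^ (∑ i : Fin k, x i) / ((∏ i : Fin k, (x i)! : ℕ) : ℝ))

/-- `m` is a mode of the mass function `f` on the non-negative integers: `f` attains its maximum
at `m`. -/
def IsMode (f : ℕ → ℝ) (m : ℕ) : Prop :=
  ∀ n : ℕ, f n ≤ f m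

/-! Write `h` for the mass function without its exponential factor, `d` for its increments, `T =
k(k+1)/2` and `N = λT` for the mean. Counting parts by size gives `n h(n) = λ ∑ (i+1) h(n-1-i)`
(`orderCoeff_rec`). Above the mean this makes `h(n)` at most `N/n < 1` times the largest value, so
the mode lies in `[0, N]`. There the sign of `d` decides. At `n = N + 1 - t`, `n t d(n)` is `λ`
times a combination of the previous `k` increments with explicit integer weights (`orderDiff_rec`).
For `t ≥ T` all weights are nonnegative, and induction gives `d > 0` (`orderDiff_pos_of_le`). Closer
to the mean some weights are negative. For `λ ≥ 3` the recurrence is run symbolically from `k`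
positive increments, with coefficients polynomial in `u = λ - 3 ≥ 0`. Up to a positive factor each
new increment is a form whose coefficients all show the required sign, a finite check for each `k`
(`diffCheck`). Hence `h` increases up to `N - ⌊k/2⌋` and decreases from there to `N`. The cases `λ =
1, 2` are computed outright. -/

/-! ### Recurrence for the mass function -/

/-- The mass function of the Poisson distribution of order `k` without its factor `e^{-k l}`,
extended by zero to the negative integers. -/
noncomputable def orderCoeff (k : ℕ) (l : ℝ) (n : ℤ) : ℝ :=
  if 0 ≤ n then
    ∑ x ∈ orderTuples k n.toNat, l ^ (∑ i : Fin k, x i) / ((∏ i : Fin k, (x i)! : ℕ) : ℝ)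
  else 0

theorem orderCoeff_natCast (k : ℕ) (l : ℝ) (n : ℕ) :
    orderCoeff k l n =
      ∑ x ∈ orderTuples k n, l ^ (∑ i : Fin k, x i) / ((∏ i : Fin k, (x i)! : ℕ) : ℝ) := by
  simp [orderCoeff]

theorem orderCoeff_of_neg (k : ℕ) (l : ℝ) {n : ℤ} (hn : n < 0) : orderCoeff k l n = 0 := by
  simp [orderCoeff, hn]

theorem poissonOrderPMF_eq (k : ℕ) (l : ℝ) (n : ℕ) :
    poissonOrderPMF k l n = Real.exp (-(k * l)) * orderCoeff k l n := by
  rw [orderCoeff_natCast, poissonOrderPMF, Finset.mul_sum]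

theorem orderCoeff_nonneg (k : ℕ) {l : ℝ} (hl : 0 ≤ l) (n : ℤ) : 0 ≤ orderCoeff k l n := by
  unfold orderCoeff
  split_ifs
  · exact Finset.sum_nonneg fun x _ => by positivity
  · exact le_rfl

theorem orderCoeff_zero (k : ℕ) (l : ℝ) : orderCoeff k l 0 = 1 := by
  have h : orderTuples k 0 = {0} := by
    ext x
    simp [mem_orderTuples, funext_iff]
  simpa [h] using orderCoeff_natCast k l 0

theorem sum_add_single {k : ℕ} (f : Fin k → ℕ) (y : Fin k → ℕ) (i : Fin k) :
    ∑ j, f j * (y + Pi.single i 1 : Fin k → ℕ) j = ∑ j, f j * y j + f i := by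
  simp [mul_add, Finset.sum_add_distrib, Pi.single_apply]

theorem prod_factorial_add_single {k : ℕ} (y : Fin k → ℕ) (i : Fin k) :
    ∏ j, ((y + Pi.single i 1 : Fin k → ℕ) j)! = (y i + 1) * ∏ j, (y j)! := by
  rw [← Finset.mul_prod_erase _ _ (Finset.mem_univ i),
    ← Finset.mul_prod_erase _ (fun j => (y j)!) (Finset.mem_univ i), ← mul_assoc]
  congr 1
  · simp [Nat.factorial_succ]
  · refine Finset.prod_congr rfl fun j hj => ?_
    simp [Finset.ne_of_mem_erase hj]

/-- Removing one part of size `i + 1` from every tuple. -/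
theorem sum_orderTuples_coord_mul {k : ℕ} (l : ℝ) (n : ℕ) (i : Fin k) :
    ∑ x ∈ orderTuples k n,
        (x i : ℝ) * (l ^ (∑ j, x j) / ((∏ j, (x j)! : ℕ) : ℝ)) =
      l * orderCoeff k l ((n : ℤ) - 1 - (i : ℕ)) := by
  by_cases hn : (i : ℕ) + 1 ≤ n
  · obtain ⟨m, rfl⟩ := Nat.exists_eq_add_of_le' hn
    have hm : (((m + ((i : ℕ) + 1) : ℕ) : ℤ) - 1 - (i : ℕ)) = (m : ℕ) := by push_cast; ring
    rw [hm, orderCoeff_natCast, Finset.mul_sum]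
    symm
    refine Finset.sum_of_injOn (fun y => y + Pi.single i 1) ?_ ?_ ?_ ?_
    · exact fun y _ z _ h => add_right_cancel h
    · intro y hy
      simp only [Finset.mem_coe, mem_orderTuples] at hy ⊢
      rw [sum_add_single, hy]
    -- A tuple outside the image has no part of this size, so its factor `x i` kills the term.
    · intro x hx hxi
      have h0 : x i = 0 := by
        by_contra h
        refine hxi ⟨x - Pi.single i 1, ?_, ?_⟩
        · have hx' := mem_orderTuples.1 hx
          have he : x = (x - Pi.single i 1) + Pi.single i 1 := by
            ext j
            by_cases hj : j = i
            · subst hj; simp; omega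
            · simp [hj]
          rw [he, sum_add_single] at hx'
          simp only [Finset.mem_coe, mem_orderTuples]
          omega
        · ext j
          by_cases hj : j = i
          · subst hj; simp; omega
          · simp [hj]
      simp [h0]
    · intro y _
      have h1 : ∑ j, (y + Pi.single i 1 : Fin k → ℕ) j = ∑ j, y j + 1 := by
        simpa using sum_add_single (fun _ => 1) y i
      have h2 : (y i : ℝ) + 1 ≠ 0 := by positivity
      have h3 : ((∏ j, (y j)! : ℕ) : ℝ) ≠ 0 := by
        exact_mod_cast Finset.prod_ne_zero_iff.2 fun j _ => Nat.factorial_ne_zero _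
      simp only [h1, prod_factorial_add_single]
      simp only [Pi.add_apply, Pi.single_eq_same, Nat.cast_mul, Nat.cast_add, Nat.cast_one]
      rw [pow_succ']
      field_simp
  · rw [orderCoeff_of_neg _ _ (by omega), mul_zero]
    refine Finset.sum_eq_zero fun x hx => ?_
    have h1 : ((i : ℕ) + 1) * x i ≤ n := by
      rw [← mem_orderTuples.1 hx]
      exact Finset.single_le_sum (f := fun j : Fin k => ((j : ℕ) + 1) * x j)
        (fun _ _ => Nat.zero_le _) (Finset.mem_univ i)
    have h0 : x i = 0 := by
      by_contra h
      have := Nat.le_mul_of_pos_right ((i : ℕ) + 1) (Nat.pos_of_ne_zero h)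
      omega
    simp [h0]

/-- Weight each tuple by `n = ∑ (i+1) x_i` and remove one part of each size in turn. -/
theorem orderCoeff_rec (k : ℕ) (l : ℝ) (n : ℤ) :
    (n : ℝ) * orderCoeff k l n =
      l * ∑ i ∈ Finset.range k, ((i : ℝ) + 1) * orderCoeff k l (n - 1 - (i : ℕ)) := by
  rcases lt_or_ge n 0 with hn | hn
  · rw [orderCoeff_of_neg _ _ hn, Finset.sum_eq_zero, mul_zero, mul_zero]
    intro i _
    rw [orderCoeff_of_neg _ _ (by omega), mul_zero]
  · lift n to ℕ using hn
    have h : ∀ x ∈ orderTuples k n,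
        ((n : ℤ) : ℝ) * (l ^ (∑ j, x j) / ((∏ j, (x j)! : ℕ) : ℝ)) =
          ∑ i : Fin k, ((i : ℕ) + 1 : ℝ) *
            ((x i : ℝ) * (l ^ (∑ j, x j) / ((∏ j, (x j)! : ℕ) : ℝ))) := by
      intro x hx
      rw [← mem_orderTuples.1 hx]
      push_cast
      rw [Finset.sum_mul]
      exact Finset.sum_congr rfl fun i _ => by ring
    rw [orderCoeff_natCast, Finset.mul_sum, Finset.sum_congr rfl h, Finset.sum_comm,
      Finset.mul_sum, Finset.sum_range]
    refine Finset.sum_congr rfl fun i _ => ?_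
    rw [← Finset.mul_sum, sum_orderTuples_coord_mul]
    ring

/-! ### Recurrence for the increments -/

/-- The increment of `orderCoeff` at `n`. -/
noncomputable def orderDiff (k : ℕ) (l : ℝ) (n : ℤ) : ℝ :=
  orderCoeff k l n - orderCoeff k l (n - 1)

/-- The coefficient of `orderDiff k l (n - 1 - i)` in the recurrence for the increments at
distance `t` below `l k (k + 1) / 2 + 1`. -/
def diffWeight (k : ℕ) (t : ℤ) (i : ℕ) : ℤ :=
  (i + 1) * t - ((k * (k + 1) / 2 : ℕ) - (i * (i + 1) / 2 : ℕ))

/-- Take `t` times the recurrence at `n` minus `t - 1` times that at `n - 1`. Since `nt - (n-1)(t-1)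
= n + t - 1 = λT`, moving `λT h(n-1)` to the right leaves coefficients with sum zero there, which
regroup into increments. -/
theorem orderDiff_rec {k : ℕ} (hk : 2 ≤ k) (hk5 : k ≤ 5) (l : ℕ) {n t : ℤ}
    (ht : n + t = l * (k * (k + 1) / 2 : ℕ) + 1) :
    (n : ℝ) * t * orderDiff k l n =
      l * ∑ i ∈ Finset.range k, (diffWeight k t i : ℝ) * orderDiff k l (n - 1 - (i : ℕ)) := by
  have h1 := orderCoeff_rec k l n
  have h2 := orderCoeff_rec k l (n - 1)
  have ht' : (n : ℝ) + t = l * (k * (k + 1) / 2 : ℕ) + 1 := by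
    have h := congrArg (Int.cast : ℤ → ℝ) ht
    simpa only [Int.cast_add, Int.cast_mul, Int.cast_natCast, Int.cast_one] using h
  have hn : (n : ℝ) = l * (k * (k + 1) / 2 : ℕ) + 1 - t := by linarith
  interval_cases k <;>
  · simp only [Finset.sum_range_succ, Finset.sum_range_zero, orderDiff, diffWeight, sub_sub]
      at h1 h2 ⊢
    norm_num at h1 h2 hn ⊢
    rw [hn] at h1 h2 ⊢
    linear_combination (t : ℝ) * h1 - ((t : ℝ) - 1) * h2

/-! ### Computable polynomials and linear forms -/

/-- The value at `u` of the polynomial with the listed coefficients, constant term first. -/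
def polyEval (u : ℝ) : List ℤ → ℝ
  | [] => 0
  | a :: p => a + u * polyEval u p

/-- Coefficientwise sum of polynomials. -/
def polyAdd : List ℤ → List ℤ → List ℤ
  | [], q => q
  | p, [] => p
  | a :: p, b :: q => (a + b) :: polyAdd p q

/-- The product of a polynomial with `a + b X`. -/
def polyMulLinear (a b : ℤ) (p : List ℤ) : List ℤ :=
  polyAdd (p.map (a * ·)) (0 :: p.map (b * ·))

theorem polyEval_add (u : ℝ) (p q : List ℤ) :
    polyEval u (polyAdd p q) = polyEval u p + polyEval u q := by
  induction p generalizing q with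
  | nil => simp [polyAdd, polyEval]
  | cons a p ih =>
    cases q with
    | nil => simp [polyAdd, polyEval]
    | cons b q =>
      simp only [polyAdd, polyEval, ih]
      push_cast
      ring

theorem polyEval_map_mul (u : ℝ) (c : ℤ) (p : List ℤ) :
    polyEval u (p.map (c * ·)) = c * polyEval u p := by
  induction p with
  | nil => simp [polyEval]
  | cons a p ih =>
    simp only [List.map_cons, polyEval, ih]
    push_cast
    ring

theorem polyEval_mulLinear (u : ℝ) (a b : ℤ) (p : List ℤ) :
    polyEval u (polyMulLinear a b p) = (a + b * u) * polyEval u p := by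
  simp only [polyMulLinear, polyEval_add, polyEval, polyEval_map_mul]
  push_cast
  ring

/-- A sufficient condition for positivity on the non-negative reals. -/
def polyPos : List ℤ → Bool
  | [] => false
  | a :: p => decide (0 < a) && p.all fun b => decide (0 ≤ b)

theorem polyEval_nonneg {u : ℝ} (hu : 0 ≤ u) {p : List ℤ} (hp : ∀ b ∈ p, 0 ≤ b) :
    0 ≤ polyEval u p := by
  induction p with
  | nil => simp [polyEval]
  | cons a p ih =>
    have ha : (0 : ℝ) ≤ a := by exact_mod_cast hp a (by simp)
    have := ih fun b hb => hp b (by simp [hb])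
    simp only [polyEval]
    positivity

theorem polyEval_pos {u : ℝ} (hu : 0 ≤ u) {p : List ℤ} (hp : polyPos p = true) :
    0 < polyEval u p := by
  cases p with
  | nil => simp [polyPos] at hp
  | cons a p =>
    simp only [polyPos, Bool.and_eq_true, decide_eq_true_eq, List.all_eq_true] at hp
    have ha : (0 : ℝ) < a := by exact_mod_cast hp.1
    have := polyEval_nonneg hu hp.2
    simp only [polyEval]
    positivity

/-- The value of the linear form in `x 0, x 1, …` whose coefficients are the listed
polynomials in `u`. -/
def formEval (u : ℝ) : (ℕ → ℝ) → List (List ℤ) → ℝ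
  | _, [] => 0
  | x, p :: r => polyEval u p * x 0 + formEval u (fun i => x (i + 1)) r

/-- Coefficientwise sum of linear forms. -/
def formAdd : List (List ℤ) → List (List ℤ) → List (List ℤ)
  | [], s => s
  | r, [] => r
  | p :: r, q :: s => polyAdd p q :: formAdd r s

theorem formEval_add (u : ℝ) (x : ℕ → ℝ) (r s : List (List ℤ)) :
    formEval u x (formAdd r s) = formEval u x r + formEval u x s := by
  induction r generalizing s x with
  | nil => simp [formAdd, formEval]
  | cons p r ih =>
    cases s with
    | nil => simp [formAdd, formEval]
    | cons q s =>
      simp only [formAdd, formEval, ih, polyEval_add]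
      ring

theorem formEval_map (u c : ℝ) (f : List ℤ → List ℤ)
    (hf : ∀ p, polyEval u (f p) = c * polyEval u p) (x : ℕ → ℝ) (r : List (List ℤ)) :
    formEval u x (r.map f) = c * formEval u x r := by
  induction r generalizing x with
  | nil => simp [formEval]
  | cons p r ih =>
    simp only [List.map_cons, formEval, ih, hf]
    ring

theorem formEval_nonneg {u : ℝ} (hu : 0 ≤ u) {x : ℕ → ℝ} {r : List (List ℤ)}
    (hx : ∀ i < r.length, 0 < x i) (hr : ∀ p ∈ r, polyPos p = true) : 0 ≤ formEval u x r := by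
  induction r generalizing x with
  | nil => simp [formEval]
  | cons p r ih =>
    have h0 := hx 0 (by simp)
    have h1 := polyEval_pos hu (hr p (by simp))
    have h2 := ih (x := fun i => x (i + 1)) (fun i hi => hx _ (by simpa using hi))
      fun q hq => hr q (by simp [hq])
    simp only [formEval]
    positivity

/-- A sufficient condition for positivity of a linear form in `k` positive unknowns. -/
def formPos (k : ℕ) (r : List (List ℤ)) : Bool :=
  !r.isEmpty && decide (r.length ≤ k) && r.all polyPos

theorem formEval_pos {u : ℝ} (hu : 0 ≤ u) {k : ℕ} {x : ℕ → ℝ} {r : List (List ℤ)}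
    (hx : ∀ i < k, 0 < x i) (hr : formPos k r = true) : 0 < formEval u x r := by
  cases r with
  | nil => simp [formPos] at hr
  | cons p r =>
    simp only [formPos, Bool.and_eq_true, decide_eq_true_eq, List.all_eq_true] at hr
    obtain ⟨⟨-, hlen⟩, hr⟩ := hr
    rw [List.length_cons] at hlen
    have h0 := hx 0 (by omega)
    have h1 := polyEval_pos hu (hr p (by simp))
    have h2 := formEval_nonneg hu (r := r) (x := fun i => x (i + 1))
      (fun i hi => hx _ (by omega))
      fun q hq => hr q (by simp [hq])
    simp only [formEval]
    positivity

/-- The linear combination of the listed forms with the listed coefficients. -/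
def formCombine : List ℤ → List (List (List ℤ)) → List (List ℤ)
  | c :: cs, r :: rs => formAdd (r.map (List.map (c * ·))) (formCombine cs rs)
  | _, _ => []

theorem formEval_combine (u : ℝ) (x : ℕ → ℝ) (c : ℕ → ℤ) (y : ℕ → ℝ) (k : ℕ)
    {S : List (List (List ℤ))} (hS : S.map (formEval u x) = (List.range k).map y) :
    formEval u x (formCombine ((List.range k).map c) S) = ∑ i ∈ Finset.range k, c i * y i := by
  induction k generalizing c y S with
  | zero => simp [formCombine, formEval]
  | succ k ih =>
    rw [List.range_succ_eq_map, List.map_cons, List.map_map] at hS ⊢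
    obtain ⟨r, S, rfl, hr, hS⟩ := List.map_eq_cons_iff.1 hS
    rw [formCombine, formEval_add, formEval_map u (c 0) _ (polyEval_map_mul u _), hr,
      ih _ _ hS, Finset.sum_range_succ', add_comm]
    simp

/-! ### Symbolic recurrence near the mean -/

/-- One step of the recurrence for the increments, for the parameter `u + 3`: from the forms of
the last `k` increments (latest first) to those at distance `t` below `l k (k + 1) / 2 + 1`, up to
a common positive factor. -/
def diffStep (k t : ℕ) (S : List (List (List ℤ))) : List (List (List ℤ)) :=
  (formCombine ((List.range k).map (diffWeight k t)) S).map (polyMulLinear 3 1) ::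
    (S.take (k - 1)).map (List.map (polyMulLinear
      (((k * (k + 1) / 2 : ℕ) * 3 + 1 - t) * t) ((k * (k + 1) / 2 : ℕ) * t)))

/-- Runs the recurrence through the distances `t, …, 1` and checks that the increment is positive
at distances greater than `k / 2` and negative at the others. -/
def diffCheck (k : ℕ) : ℕ → List (List (List ℤ)) → Bool
  | 0, _ => true
  | t + 1, S =>
    (match (diffStep k (t + 1) S).head? with
      | none => false
      | some r => if k / 2 < t + 1 then formPos k r
          else formPos k (r.map (List.map ((-1 : ℤ) * ·)))) &&
    diffCheck k t (diffStep k (t + 1) S)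

/-- The forms `x 0, …, x (k - 1)`. -/
def initialForms (k : ℕ) : List (List (List ℤ)) :=
  (List.range k).map fun i => (List.range k).map fun j => [if i = j then 1 else 0]

theorem diffCheck_two : diffCheck 2 6 (initialForms 2) = true := by decide +kernel
theorem diffCheck_three : diffCheck 3 14 (initialForms 3) = true := by decide +kernel
theorem diffCheck_four : diffCheck 4 18 (initialForms 4) = true := by decide +kernel
theorem diffCheck_five : diffCheck 5 20 (initialForms 5) = true := by decide +kernel

/-- To avoid dividing by `n t`, the older forms are multiplied by it instead. With `λ = 3 + u`, both
`λ` and `n t` are linear in `u`. -/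
theorem map_formEval_diffStep {k : ℕ} (hk : 2 ≤ k) (hk5 : k ≤ 5) (l : ℕ) (x : ℕ → ℝ) {t : ℕ}
    {n : ℤ} (hn : n + t = l * (k * (k + 1) / 2 : ℕ) + 1) {P : ℝ} {S : List (List (List ℤ))}
    (hS : S.map (formEval ((l : ℝ) - 3) x) =
      (List.range k).map fun i => P * orderDiff k l (n - 1 - (i : ℕ))) :
    (diffStep k t S).map (formEval ((l : ℝ) - 3) x) =
      (List.range k).map fun i => P * (n * t) * orderDiff k l (n - (i : ℕ)) := by
  obtain ⟨j, rfl⟩ : ∃ j, k = j + 1 := ⟨k - 1, by omega⟩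
  have hrec := orderDiff_rec hk hk5 l hn
  have hn' : (n : ℝ) + t = l * ((j + 1) * (j + 1 + 1) / 2 : ℕ) + 1 := by
    have h := congrArg (Int.cast : ℤ → ℝ) hn
    simpa only [Int.cast_add, Int.cast_mul, Int.cast_natCast, Int.cast_one] using h
  have hcomb := formEval_combine _ _ (diffWeight (j + 1) t) _ _ hS
  rw [List.range_succ_eq_map, List.map_cons] at hcomb
  rw [diffStep, List.map_cons, List.range_succ_eq_map, List.map_cons]
  congr 1
  · rw [formEval_map _ _ _ (polyEval_mulLinear _ _ _), hcomb]
    have h : ∑ i ∈ Finset.range (j + 1), (diffWeight (j + 1) t i : ℝ) *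
        (P * orderDiff (j + 1) l (n - 1 - (i : ℕ))) =
        P * ∑ i ∈ Finset.range (j + 1), (diffWeight (j + 1) t i : ℝ) *
          orderDiff (j + 1) l (n - 1 - (i : ℕ)) := by
      rw [Finset.mul_sum]
      exact Finset.sum_congr rfl fun i _ => by ring
    rw [h]
    push_cast at hrec ⊢
    rw [sub_zero]
    linear_combination -P * hrec
  · have hc : ∀ r : List (List ℤ), formEval ((l : ℝ) - 3) x (r.map (polyMulLinear
        ((((j + 1) * (j + 1 + 1) / 2 : ℕ) * 3 + 1 - t) * t)
        (((j + 1) * (j + 1 + 1) / 2 : ℕ) * t))) =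
        (n * t) * formEval ((l : ℝ) - 3) x r := by
      intro r
      rw [formEval_map _ _ _ (polyEval_mulLinear _ _ _)]
      congr 1
      simp only [Int.cast_mul, Int.cast_add, Int.cast_sub, Int.cast_natCast, Int.cast_one,
        Int.cast_ofNat]
      linear_combination -(t : ℝ) * hn'
    have htake := congrArg (List.take j) hS
    rw [← List.map_take, ← List.map_take, List.take_range, min_eq_left (by omega)] at htake
    rw [Nat.add_sub_cancel, List.map_map, List.map_map]
    have h := congrArg (List.map ((n * t : ℝ) * ·)) htake
    rw [List.map_map, List.map_map] at h
    convert h using 2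
    · funext r
      exact hc r
    · funext i
      simp only [Function.comp_apply]
      have : n - 1 - (i : ℤ) = n - (i.succ : ℕ) := by push_cast; ring
      rw [this]
      ring

theorem orderDiff_sign_of_diffCheck {k : ℕ} (hk : 2 ≤ k) (hk5 : k ≤ 5) {l : ℕ} (hl : 3 ≤ l)
    {x : ℕ → ℝ} (hx : ∀ i < k, 0 < x i) {t : ℕ} (ht : t ≤ l * (k * (k + 1) / 2))
    {P : ℝ} (hP : 0 < P) {S : List (List (List ℤ))}
    (hS : S.map (formEval ((l : ℝ) - 3) x) = (List.range k).map fun i =>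
      P * orderDiff k l ((l * (k * (k + 1) / 2) : ℕ) - t - (i : ℕ)))
    (hc : diffCheck k t S = true) {s : ℕ} (hs : s < t) :
    (k / 2 ≤ s → 0 < orderDiff k l ((l * (k * (k + 1) / 2) : ℕ) - s)) ∧
      (s < k / 2 → orderDiff k l ((l * (k * (k + 1) / 2) : ℕ) - s) < 0) := by
  induction t generalizing P S with
  | zero => omega
  | succ t ih =>
    have hu : (0 : ℝ) ≤ (l : ℝ) - 3 := by
      have : (3 : ℝ) ≤ l := by exact_mod_cast hl
      linarith
    set n : ℤ := ((l * (k * (k + 1) / 2) : ℕ) : ℤ) - t with hn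
    have hn1 : n + (t + 1 : ℕ) = l * (k * (k + 1) / 2 : ℕ) + 1 := by
      rw [hn]; push_cast; ring
    have hnpos : 0 < n := by omega
    have hP' : 0 < P * (n * (t + 1 : ℕ)) := by
      have : (0 : ℝ) < n := by exact_mod_cast hnpos
      positivity
    have hstep := map_formEval_diffStep hk hk5 l x hn1 (P := P) (S := S) (by
      rw [hS]
      refine List.map_congr_left fun i _ => ?_
      rw [hn]
      push_cast
      congr 2
      ring)
    rw [diffCheck, Bool.and_eq_true] at hc
    rcases Nat.lt_succ_iff_lt_or_eq.1 hs with h | rfl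
    · exact ih (by omega) hP' hstep hc.2 h
    · have hhead : formEval ((l : ℝ) - 3) x ((diffStep k (s + 1) S).headD []) =
          P * (n * (s + 1 : ℕ)) * orderDiff k l n := by
        obtain ⟨j, rfl⟩ : ∃ j, k = j + 1 := ⟨k - 1, by omega⟩
        rw [List.range_succ_eq_map, List.map_cons] at hstep
        simpa [diffStep] using (List.cons.inj hstep).1
      have hc1 := hc.1
      simp only [diffStep, List.head?_cons] at hc1
      simp only [diffStep, List.headD_cons] at hhead
      constructor
      · intro h
        rw [if_pos (by omega)] at hc1
        have := formEval_pos hu hx hc1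
        rw [hhead] at this
        -- The accumulated factor is positive because `n` and the distance are, so the sign of the
        -- form is that of the increment.
        exact (pos_iff_pos_of_mul_pos this).1 hP'
      · intro h
        rw [if_neg (by omega)] at hc1
        have := formEval_pos hu hx hc1
        rw [formEval_map _ _ _ (polyEval_map_mul _ _), hhead] at this
        push_cast at this hP'
        by_contra hd
        have := mul_nonneg hP'.le (not_lt.1 hd)
        linarith

theorem map_formEval_initialForms {k : ℕ} (hk : 2 ≤ k) (hk5 : k ≤ 5) (u : ℝ) (x : ℕ → ℝ) :
    (initialForms k).map (formEval u x) = (List.range k).map x := by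
  interval_cases k <;> simp [initialForms, List.range_succ, formEval, polyEval]

/-! ### Increments far below the mean -/

theorem orderDiff_of_neg (k : ℕ) (l : ℝ) {n : ℤ} (hn : n < 0) : orderDiff k l n = 0 := by
  rw [orderDiff, orderCoeff_of_neg _ _ hn, orderCoeff_of_neg _ _ (by omega), sub_zero]

theorem diffWeight_nonneg {k : ℕ} {t : ℤ}
    (ht : (k * (k + 1) / 2 : ℕ) ≤ t) (i : ℕ) : 0 ≤ diffWeight k t i := by
  unfold diffWeight
  have h1 : (0 : ℤ) ≤ i * t := by
    have : (0 : ℤ) ≤ t := le_trans (by positivity) ht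
    positivity
  have h2 : (0 : ℤ) ≤ (i * (i + 1) / 2 : ℕ) := by positivity
  linarith

/-- Far below the mean the increments are positive, by induction. -/
theorem orderDiff_pos_of_le {k : ℕ} (hk : 2 ≤ k) (hk5 : k ≤ 5) {l : ℕ} (hl : 2 ≤ l) (n : ℕ)
    (hn : n + k * (k + 1) / 2 ≤ l * (k * (k + 1) / 2) + 1) : 0 < orderDiff k l n := by
  have hl' : (2 : ℝ) ≤ l := by exact_mod_cast hl
  induction n using Nat.strong_induction_on with
  | _ n ih =>
    match n with
    | 0 => simp [orderDiff, orderCoeff_zero, orderCoeff_of_neg]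
    | 1 =>
      have h := orderCoeff_rec k l 1
      have h0 : ∑ i ∈ Finset.range k, ((i : ℝ) + 1) * orderCoeff k l (1 - 1 - (i : ℕ)) = 1 := by
        rw [Finset.sum_eq_single 0]
        · simp [orderCoeff_zero]
        · intro i _ hi
          rw [orderCoeff_of_neg _ _ (by omega), mul_zero]
        · intro h; simp at h; omega
      rw [h0] at h
      simp only [Int.cast_one, one_mul, mul_one] at h
      -- The increment is `l - 1`; this base case is where `2 ≤ l` is needed.
      rw [Nat.cast_one, orderDiff, h, sub_self, orderCoeff_zero]
      linarith
    | n + 2 =>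
      set t : ℤ := l * (k * (k + 1) / 2 : ℕ) + 1 - (n + 2 : ℕ) with ht
      have htw : ((k * (k + 1) / 2 : ℕ) : ℤ) ≤ t := by
        rw [ht]; zify at hn; push_cast at hn ⊢; linarith
      have hw : 2 < k * (k + 1) / 2 := by
        interval_cases k <;> decide
      have htpos : (0 : ℝ) < t := by
        have : 0 < t := by omega
        exact_mod_cast this
      have hrec := orderDiff_rec hk hk5 l (n := (n + 2 : ℕ)) (t := t) (by rw [ht]; ring)
      have hsum : 0 < ∑ i ∈ Finset.range k, (diffWeight k t i : ℝ) *
          orderDiff k l (((n + 2 : ℕ) : ℤ) - 1 - (i : ℕ)) := by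
        -- The weight at `i = 0` is `t - T`, which may vanish; the one at `i = 1` is `2t - T + 1 >
        -- 0`.
        refine Finset.sum_pos' (fun i _ => ?_) ⟨1, Finset.mem_range.2 (by omega), ?_⟩
        · refine mul_nonneg (by exact_mod_cast diffWeight_nonneg htw i) ?_
          rcases lt_or_ge (n + 1) i with hi | hi
          · rw [orderDiff_of_neg _ _ (by push_cast; omega)]
          · have he : ((n + 2 : ℕ) : ℤ) - 1 - (i : ℕ) = ((n + 1 - i : ℕ) : ℤ) := by omega
            rw [he]
            exact (ih _ (by omega) (by omega)).le
        · have he : ((n + 2 : ℕ) : ℤ) - 1 - (1 : ℕ) = (n : ℕ) := by push_cast; ring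
          rw [he]
          refine mul_pos ?_ (ih _ (by omega) (by omega))
          have : 0 < diffWeight k t 1 := by
            unfold diffWeight
            simp only [Nat.cast_one]
            omega
          exact_mod_cast this
      have hpos : 0 < (((n + 2 : ℕ) : ℤ) : ℝ) * t * orderDiff k l (n + 2 : ℕ) := by
        rw [hrec]
        exact mul_pos (by linarith) hsum
      refine (pos_iff_pos_of_mul_pos hpos).1 (mul_pos ?_ htpos)
      rw [Int.cast_natCast]
      positivity

/-! ### Signs of all increments up to the mean -/

/-- The first bound puts the `k` starting increments in the range of `orderDiff_pos_of_le`; the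
second keeps their indices nonnegative for every `λ ≥ 3`. -/
theorem exists_diffCheck {k : ℕ} (hk : 2 ≤ k) (hk5 : k ≤ 5) :
    ∃ T, k * (k + 1) / 2 ≤ T + 1 ∧ T + k ≤ 3 * (k * (k + 1) / 2) + 1 ∧
      diffCheck k T (initialForms k) = true := by
  interval_cases k
  · exact ⟨6, by decide, by decide, diffCheck_two⟩
  · exact ⟨14, by decide, by decide, diffCheck_three⟩
  · exact ⟨18, by decide, by decide, diffCheck_four⟩
  · exact ⟨20, by decide, by decide, diffCheck_five⟩

theorem orderDiff_sign {k : ℕ} (hk : 2 ≤ k) (hk5 : k ≤ 5) {l : ℕ} (hl : 3 ≤ l) {s : ℕ}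
    (hs : s ≤ l * (k * (k + 1) / 2)) :
    (k / 2 ≤ s → 0 < orderDiff k l ((l * (k * (k + 1) / 2) : ℕ) - s)) ∧
      (s < k / 2 → orderDiff k l ((l * (k * (k + 1) / 2) : ℕ) - s) < 0) := by
  obtain ⟨T, hT1, hT2, hT⟩ := exists_diffCheck hk hk5
  have h3 : 3 * (k * (k + 1) / 2) ≤ l * (k * (k + 1) / 2) := Nat.mul_le_mul_right _ hl
  have hfar : ∀ r : ℕ, T ≤ r → r ≤ l * (k * (k + 1) / 2) →
      0 < orderDiff k l ((l * (k * (k + 1) / 2) : ℕ) - r) := by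
    intro r hr hr'
    rw [← Nat.cast_sub hr']
    exact orderDiff_pos_of_le hk hk5 (by omega) _ (by omega)
  rcases lt_or_ge s T with h | h
  · refine orderDiff_sign_of_diffCheck hk hk5 hl
      (x := fun i => orderDiff k l ((l * (k * (k + 1) / 2) : ℕ) - T - (i : ℕ))) ?_ (by omega)
      one_pos ?_ hT h
    · intro i hi
      have := hfar (T + i) (by omega) (by omega)
      simpa [sub_sub] using this
    · simp only [one_mul]
      exact map_formEval_initialForms hk hk5 _ _
  · refine ⟨fun _ => hfar s h hs, fun h' => ?_⟩
    interval_cases k <;> omega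

/-! ### Direct computation for parameters 1 and 2 -/

/-- The values `orderCoeff k l n, …, orderCoeff k l 0`, as rational numbers. -/
def coeffList (k l : ℕ) : ℕ → List ℚ
  | 0 => [1]
  | n + 1 => (l / (n + 1) *
      ((List.range k).map fun i : ℕ => ((i : ℚ) + 1) * (coeffList k l n).getD i 0).sum) ::
        coeffList k l n

/-- The default `0` past the end of the list matches the extension of `orderCoeff` by zero. -/
theorem coeffList_getD (k l n i : ℕ) :
    (((coeffList k l n).getD i 0 : ℚ) : ℝ) = orderCoeff k l ((n : ℤ) - (i : ℕ)) := by
  induction n generalizing i with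
  | zero =>
    cases i with
    | zero => simp [coeffList, orderCoeff_zero]
    | succ i => rw [orderCoeff_of_neg _ _ (by omega)]; simp [coeffList]
  | succ n ih =>
    cases i with
    | zero =>
      have h := orderCoeff_rec k l ((n + 1 : ℕ) : ℤ)
      have h0 : ((n : ℝ) + 1) ≠ 0 := by positivity
      have hs : (((List.range k).map fun i : ℕ =>
          ((i : ℚ) + 1) * (coeffList k l n).getD i 0).sum : ℚ) =
          ∑ i ∈ Finset.range k, ((i : ℚ) + 1) * (coeffList k l n).getD i 0 := rfl
      simp only [coeffList, List.getD_cons_zero, hs]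
      push_cast at h ⊢
      simp only [ih]
      rw [sub_zero, div_mul_eq_mul_div, div_eq_iff h0, mul_comm (orderCoeff _ _ _), h]
      simp only [add_sub_cancel_right]
    | succ i =>
      simp only [coeffList, List.getD_cons_succ, ih]
      congr 1
      push_cast
      ring

theorem coeffList_lt {k l : ℕ} (hk : 2 ≤ k) (hk5 : k ≤ 5) (hl : 1 ≤ l) (hl2 : l ≤ 2) :
    ∀ s < l * (k * (k + 1) / 2) + 1, s ≠ k / 2 →
      (coeffList k l (l * (k * (k + 1) / 2))).getD s 0 <
        (coeffList k l (l * (k * (k + 1) / 2))).getD (k / 2) 0 := by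
  interval_cases k <;> interval_cases l <;> decide +kernel

/-! ### Location and uniqueness of the mode -/

theorem half_le {k l : ℕ} (hl : 1 ≤ l) : k / 2 ≤ l * (k * (k + 1) / 2) :=
  calc k / 2 ≤ k * (k + 1) / 2 := Nat.div_le_div_right (Nat.le_mul_of_pos_right _ k.succ_pos)
    _ ≤ l * (k * (k + 1) / 2) := Nat.le_mul_of_pos_left _ hl

theorem lt_of_sign_changes {A : ℤ → ℝ} {N c : ℕ}
    (hpos : ∀ s : ℕ, c ≤ s → s ≤ N → A ((N : ℤ) - s - 1) < A ((N : ℤ) - s))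
    (hneg : ∀ s : ℕ, s < c → A ((N : ℤ) - s) < A ((N : ℤ) - s - 1)) {s : ℕ} (hs : s ≤ N)
    (hsc : s ≠ c) : A ((N : ℤ) - s) < A ((N : ℤ) - c) := by
  have hshift : ∀ r : ℕ, (N : ℤ) - r - 1 = N - (r + 1 : ℕ) := fun r => by push_cast; ring
  simp only [hshift] at hpos hneg
  rcases lt_or_gt_of_ne hsc with h | h
  · have hchain : ∀ r, s + 1 ≤ r → r ≤ c → A ((N : ℤ) - s) < A ((N : ℤ) - r) := by
      intro r hr
      induction r, hr using Nat.le_induction with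
      | base => exact fun h => hneg s h
      | succ r _ ih => exact fun h => (ih (by omega)).trans (hneg r h)
    exact hchain c h le_rfl
  · induction s, h using Nat.le_induction with
    | base => exact hpos c le_rfl (by omega)
    | succ s h ih =>
      have h' : c + 1 ≤ s := h
      exact (hpos s (by omega) (by omega)).trans (ih (by omega) (by omega))

theorem orderCoeff_lt_of_le {k l : ℕ} (hk : 2 ≤ k) (hk5 : k ≤ 5) (hl : 1 ≤ l) {s : ℕ}
    (hs : s ≤ l * (k * (k + 1) / 2)) (hsk : s ≠ k / 2) :
    orderCoeff k l ((l * (k * (k + 1) / 2) : ℕ) - (s : ℕ)) <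
      orderCoeff k l ((l * (k * (k + 1) / 2) : ℕ) - (k / 2 : ℕ)) := by
  rcases Nat.lt_or_ge l 3 with h | h
  · rw [← coeffList_getD, ← coeffList_getD]
    exact_mod_cast coeffList_lt hk hk5 hl (by omega) s (by omega) hsk
  · refine lt_of_sign_changes (fun r h1 h2 => ?_) (fun r h1 => ?_) hs hsk
    · exact sub_pos.1 ((orderDiff_sign hk hk5 h h2).1 h1)
    · exact sub_neg.1 ((orderDiff_sign hk hk5 h (h1.le.trans (half_le hl))).2 h1)

theorem orderCoeff_lt {k l : ℕ} (hk : 2 ≤ k) (hk5 : k ≤ 5) (hl : 1 ≤ l) (n : ℕ)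
    (hn : n ≠ l * (k * (k + 1) / 2) - k / 2) :
    orderCoeff k l n < orderCoeff k l ((l * (k * (k + 1) / 2) - k / 2 : ℕ) : ℤ) := by
  have hhalf := half_le (k := k) hl
  set N := l * (k * (k + 1) / 2) with hN
  induction n using Nat.strong_induction_on with
  | _ n ih =>
    rcases Nat.lt_or_ge N n with h | h
    · have hle : ∀ i : ℕ, orderCoeff k l ((n : ℤ) - 1 - (i : ℕ)) ≤
          orderCoeff k l ((N - k / 2 : ℕ) : ℤ) := by
        intro i
        rcases Nat.lt_or_ge (n - 1) i with hi | hi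
        · rw [orderCoeff_of_neg _ _ (by omega)]
          exact orderCoeff_nonneg _ (Nat.cast_nonneg _) _
        · have he : (n : ℤ) - 1 - (i : ℕ) = (n - 1 - i : ℕ) := by omega
          rw [he]
          by_cases hi' : n - 1 - i = N - k / 2
          · rw [hi']
          · exact (ih _ (by omega) hi').le
      -- The weights of the recurrence total the mean, so past it each value is below the bound on
      -- its predecessors.
      have hsum : (l : ℝ) * ∑ i ∈ Finset.range k, ((i : ℝ) + 1) = N := by
        rw [hN]
        interval_cases k <;> norm_num [Finset.sum_range_succ]
      -- Positivity makes the last inequality, from `N < n`, strict.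
      have hpos : 0 < orderCoeff k l ((N - k / 2 : ℕ) : ℤ) := by
        have h1 : (N : ℤ) - (k / 2 : ℕ) = (N - k / 2 : ℕ) := by omega
        rw [← h1]
        by_cases hz : N = k / 2
        · rw [hz, sub_self, orderCoeff_zero]
          exact one_pos
        · exact (orderCoeff_nonneg _ (Nat.cast_nonneg _) _).trans_lt
            (orderCoeff_lt_of_le hk hk5 hl le_rfl hz)
      have hn0 : (0 : ℝ) < n := by exact_mod_cast Nat.zero_lt_of_lt h
      refine lt_of_mul_lt_mul_left ?_ hn0.le
      calc (n : ℝ) * orderCoeff k l n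
          = l * ∑ i ∈ Finset.range k, ((i : ℝ) + 1) * orderCoeff k l ((n : ℤ) - 1 - (i : ℕ)) := by
            simpa using orderCoeff_rec k l n
        _ ≤ l * ∑ i ∈ Finset.range k, ((i : ℝ) + 1) * orderCoeff k l ((N - k / 2 : ℕ) : ℤ) := by
            gcongr with i
            exact hle i
        _ = N * orderCoeff k l ((N - k / 2 : ℕ) : ℤ) := by
            rw [← Finset.sum_mul, ← mul_assoc, hsum]
        _ < n * orderCoeff k l ((N - k / 2 : ℕ) : ℤ) := by
            have : (N : ℝ) < n := by exact_mod_cast h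
            gcongr
    · have h1 := orderCoeff_lt_of_le hk hk5 hl (s := N - n) (by omega) (by omega)
      have h2 : (N : ℤ) - (N - n : ℕ) = n := by omega
      have h3 : (N : ℤ) - (k / 2 : ℕ) = (N - k / 2 : ℕ) := by omega
      rwa [← hN, h2, h3] at h1

theorem isMode_iff {k l : ℕ} (hk : 2 ≤ k) (hk5 : k ≤ 5) (hl : 1 ≤ l) (m : ℕ) :
    IsMode (poissonOrderPMF k (l : ℝ)) m ↔ m = l * (k * (k + 1) / 2) - k / 2 := by
  simp only [IsMode, poissonOrderPMF_eq, mul_le_mul_iff_right₀ (Real.exp_pos _)]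
  constructor
  · intro h
    by_contra hm
    exact (orderCoeff_lt hk hk5 hl m hm).not_ge (h _)
  · rintro rfl n
    by_cases hn : n = l * (k * (k + 1) / 2) - k / 2
    · rw [hn]
    · exact (orderCoeff_lt hk hk5 hl n hn).le

theorem theorem2p2 (k l : ℕ) (hk : 2 ≤ k) (hk5 : k ≤ 5) (hl : 1 ≤ l) :
    (∃! m : ℕ, IsMode (poissonOrderPMF k (l : ℝ)) m) ∧
      ∀ m : ℕ, IsMode (poissonOrderPMF k (l : ℝ)) m →
        (m : ℝ) = (l : ℝ) * k * (k + 1) / 2 - (⌊(k : ℝ) / 2⌋ : ℝ) := by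
  simp only [isMode_iff hk hk5 hl]
  refine ⟨⟨_, rfl, fun _ h => h⟩, ?_⟩
  rintro _ rfl
  have hfloor : ⌊(k : ℝ) / 2⌋ = ((k / 2 : ℕ) : ℤ) := by
    rw [Int.floor_eq_iff]
    interval_cases k <;> norm_num
  rw [Nat.cast_sub (half_le hl), hfloor, Int.cast_natCast, Nat.cast_mul,
    Nat.cast_div (Nat.even_mul_succ_self k).two_dvd two_ne_zero]
  push_cast
  ring
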